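/- Let $n,d,e\ge 0$ be integers with $e\le d+1$, and let $\mathbb{C}[x]=\mathbb{C}[x_1,\dots,x_n]$. For $m\ge 0$, the Taylor variety $\mathcal{T}^n_{d,e,m}$ is the Zariski closure, in the projective space $\mathbb{P}^{\binom{n+m}{n}-1}$ of polynomials of degree $\le m$ in $\mathbb{C}[x]$ up to scaling, of the set of all Taylor polynomials of order $m$ at the origin (that is, Taylor series truncated after the terms of degree $m$) of rational functions $P/Q$ with $P,Q\in\mathbb{C}[x]$, $\deg P\le d$, $\deg Q\le e$ and $P(0)=Q(0)=1$. Let $I\subset\mathbb{C}[x]$ be the ideal generated by $e$ general forms of degrees $d,d-1,\dots,d-e+1$. Then the value of its Hilbert function in degree $d+1$ is the codimension of $\mathcal{T}^n_{d,e,d+1}$: $$\dim_{\mathbb{C}}\bigl(\mathbb{C}[x]_{d+1}/I_{d+1}\bigr)\;=\;\binom{n+d+1}{n}-1-\dim\mathcal{T}^n_{d,e,d+1}.$$ Here $\mathbb{C}[x]_{d+1}$ is the space of forms of degree $d+1$ and $I_{d+1}=I\cap\mathbb{C}[x]_{d+1}$. "General" means that the claim holds for all tuples of forms in a nonempty Zariski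 open subset of the space of tuples of forms of the given degrees (which may depend on $n,d,e$). -/

import Mathlib

open scoped LinearAlgebra.Projectivization

noncomputable section

namespace Taylor

/-- The `ℂ`-vector space `ℂ[x]_{≤ m}` of polynomials of degree at most `m` in `n` variables. -/
abbrev PolyLE (n m : ℕ) : Submodule ℂ (MvPolynomial (Fin n) ℂ) :=
  MvPolynomial.restrictTotalDegree (Fin n) ℂ m

/-- Exponents `γ` with `|γ| ≤ m`: the index set of the coordinates `c_γ` on `ℂ[x]_{≤ m}`. -/
abbrev ExpLE (n m : ℕ) : Type := {γ : Fin n →₀ ℕ // γ.degree ≤ m}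

/-- The projective space of polynomials of degree at most `m` in `n` variables, up to scaling;
its dimension is `(n + m).choose n - 1`. -/
abbrev ProjSpace (n m : ℕ) : Type := ℙ ℂ (PolyLE n m)

/-- The coordinates `(c_γ)_{|γ| ≤ m}` of `T = ∑ c_γ x^γ`. -/
def coords {n m : ℕ} (T : PolyLE n m) : ExpLE n m → ℂ :=
  fun γ => MvPolynomial.coeff γ.1 (T : MvPolynomial (Fin n) ℂ)

/-- The polynomial `F` in the coordinates `c_γ` vanishes at all representatives of the projective
point `p`. (For homogeneous `F` it is equivalent to ask this of one nonzero representative.) -/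
def VanishesAt {n m : ℕ} (F : MvPolynomial (ExpLE n m) ℂ) (p : ProjSpace n m) : Prop :=
  ∀ T ∈ p.submodule, MvPolynomial.eval (coords T) F = 0

/-- `F` is homogeneous of some degree and vanishes on the set `X`. -/
def IsFormVanishingOn {n m : ℕ} (X : Set (ProjSpace n m))
    (F : MvPolynomial (ExpLE n m) ℂ) : Prop :=
  (∃ k : ℕ, F.IsHomogeneous k) ∧ ∀ p ∈ X, VanishesAt F p

/-- The closure of `X` in projective space with respect to the Zariski topology. -/
def zariskiClosure {n m : ℕ} (X : Set (ProjSpace n m)) : Set (ProjSpace n m) :=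
  {p | ∀ F : MvPolynomial (ExpLE n m) ℂ, IsFormVanishingOn X F → VanishesAt F p}

/-- The homogeneous ideal of `X`, in the polynomial ring `ℂ[c]`. -/
def homogeneousIdeal {n m : ℕ} (X : Set (ProjSpace n m)) :
    Ideal (MvPolynomial (ExpLE n m) ℂ) :=
  Ideal.span {F | IsFormVanishingOn X F}

/-- The projective variety `X` has dimension `k`: its homogeneous coordinate ring has Krull
dimension `k + 1`. -/
def HasDimension {n m : ℕ} (X : Set (ProjSpace n m)) (k : ℕ) : Prop :=
  ringKrullDim (MvPolynomial (ExpLE n m) ℂ ⧸ homogeneousIdeal X) = (k : WithBot ℕ∞) + 1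

/-- The projective variety `X` has codimension `r` in its ambient projective space, which has
dimension `(n + m).choose n - 1`. -/
def HasCodimension {n m : ℕ} (X : Set (ProjSpace n m)) (r : ℕ) : Prop :=
  ∃ k : ℕ, HasDimension X k ∧ k + r = (n + m).choose n - 1

/-- `T` is the Taylor polynomial of order `m` at the origin of a rational function `P / Q` with
`deg P ≤ d`, `deg Q ≤ e` and `P(0) = Q(0) = 1`. The quotient is formed in the ring of formal power
series, where `Q` is invertible; `truncTotal (m + 1)` keeps the terms of total degree `≤ m`. -/
def IsTaylorPolynomial (n d e m : ℕ) (T : MvPolynomial (Fin n) ℂ) : Prop :=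
  ∃ P Q : MvPolynomial (Fin n) ℂ,
    P.totalDegree ≤ d ∧ Q.totalDegree ≤ e ∧
    MvPolynomial.constantCoeff P = 1 ∧ MvPolynomial.constantCoeff Q = 1 ∧
    T = MvPowerSeries.truncTotal (m + 1)
      ((P : MvPowerSeries (Fin n) ℂ) * (Q : MvPowerSeries (Fin n) ℂ)⁻¹)

/-- The Taylor variety `𝒯^n_{d,e,m}`: the Zariski closure in projective space of the set of all
Taylor polynomials of order `m` of rational functions of degree `(d, e)` in `n` variables. -/
def taylorVariety (n d e m : ℕ) : Set (ProjSpace n m) :=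
  zariskiClosure {p | ∃ (T : PolyLE n m) (hT : T ≠ 0),
    IsTaylorPolynomial n d e m (T : MvPolynomial (Fin n) ℂ) ∧
    p = Projectivization.mk ℂ T hT}

/-- The homogeneous component `I_k = I ∩ ℂ[x]_k`, as a subspace of the space `ℂ[x]_k` of forms of
degree `k`. -/
def idealComponent {n : ℕ} (I : Ideal (MvPolynomial (Fin n) ℂ)) (k : ℕ) :
    Submodule ℂ (MvPolynomial.homogeneousSubmodule (Fin n) ℂ k) :=
  (I.restrictScalars ℂ).comap (MvPolynomial.homogeneousSubmodule (Fin n) ℂ k).subtype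

/-- The Hilbert function of a homogeneous ideal: `k ↦ dim_ℂ (ℂ[x]_k / I_k)`. -/
def hilbertFunction {n : ℕ} (I : Ideal (MvPolynomial (Fin n) ℂ)) (k : ℕ) : ℕ :=
  Module.finrank ℂ (MvPolynomial.homogeneousSubmodule (Fin n) ℂ k ⧸ idealComponent I k)

/-- Tuples of forms `f_i` in `n` variables, `i < e`, where `f_i` has degree `deg i`. -/
abbrev FormTuple (n : ℕ) {e : ℕ} (deg : Fin e → ℕ) : Type :=
  (i : Fin e) → MvPolynomial.homogeneousSubmodule (Fin n) ℂ (deg i)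

/-- Coordinates on the affine space of tuples of forms: one for each coefficient of each form. -/
abbrev FormIndex (n : ℕ) {e : ℕ} (deg : Fin e → ℕ) : Type :=
  (i : Fin e) × {γ : Fin n →₀ ℕ // γ.degree = deg i}

/-- The vector of all coefficients of a tuple of forms. -/
def formCoords {n e : ℕ} {deg : Fin e → ℕ} (f : FormTuple n deg) : FormIndex n deg → ℂ :=
  fun j => MvPolynomial.coeff j.2.1 (f j.1 : MvPolynomial (Fin n) ℂ)

/-- The property `p` holds for general forms of degrees `deg 0, …, deg (e - 1)`: it holds on a
nonempty Zariski open subset of the affine space of such tuples of forms, namely (which is no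
restriction) on the complement of the zero set of one nonzero polynomial in their coefficients. -/
def ForGeneralForms (n : ℕ) {e : ℕ} (deg : Fin e → ℕ) (p : FormTuple n deg → Prop) : Prop :=
  ∃ G : MvPolynomial (FormIndex n deg) ℂ, G ≠ 0 ∧
    ∀ f : FormTuple n deg, MvPolynomial.eval (formCoords f) G ≠ 0 → p f

end Taylor

end

/-!
# Taylor varieties and ideals of general forms

Write a polynomial `T` of degree at most `d + 1` with `T(0) = 1` as `T = t + T_{d+1}`, where `t`
collects the terms of degree at most `d`. A denominator `Q = 1 - q`, where `q` has terms of degrees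
`1, …, e`, makes `T` a Taylor polynomial exactly when `Q * T` has no term of degree `d + 1`, that
is, when `T_{d+1}` is the part of degree `d + 1` of `q * t`. For fixed `t` this part depends
linearly on the coefficients of `q`; the matrix `M(t)` of this linear map (`Taylor.topMatrix`) has
as its columns the products `x^β t_{d+1-|β|}`. So the cone over the Taylor variety is the closure
of the image of `(t, q) ↦ (t, M(t) q)` (`Taylor.param`), and its dimension is the number of
coefficients of `t` plus the generic rank of `M`.

On the other hand the columns of `M(t)` span the part of degree `d + 1` of the ideal generated by
the homogeneous components of `t` of degrees `d, …, d - e + 1` (`Taylor.map_idealComponent`). For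
general forms the Hilbert function in degree `d + 1` is therefore the number of monomials of degree
`d + 1` minus the same generic rank, which is the codimension of the Taylor variety.

Both occurrences of the generic rank are controlled by `Matrix.exists_row_basis`: over a domain, up
to one denominator `g`, some rows of `M` have a right inverse and generate all rows. Hence `M(t)`
has the generic rank wherever `g(t) ≠ 0` (`Matrix.rank_map_of_row_basis`), and the coordinate ring
of the cone has an explicit transcendence basis (`ringKrullDim_quotient_ker_of_row_basis`). Krull
dimension and transcendence degree agree by Noether normalization
(`IsTranscendenceBasis.ringKrullDim_eq`). That the homogeneous ideal of the Taylor variety is the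
kernel of the map dual to the parametrization is `Taylor.homogeneousIdeal_taylorVariety`.
-/

/-! ### Krull dimension and transcendence degree -/

theorem ringKrullDim_eq_of_isIntegral {R S : Type*} [CommRing R] [CommRing S] [Algebra R S]
    [Algebra.IsIntegral R S] (hinj : Function.Injective (algebraMap R S)) :
    ringKrullDim R = ringKrullDim S := by
  apply le_antisymm
  · refine iSup_le fun l => ?_
    obtain ⟨P, -, hP, hPl⟩ := Ideal.exists_ideal_over_prime_of_isIntegral l.head.asIdeal
      (⊥ : Ideal S) (by
        rw [← RingHom.ker_eq_comap_bot, (RingHom.injective_iff_ker_eq_bot _).1 hinj]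
        exact bot_le)
    have : P.LiesOver l.head.asIdeal := ⟨hPl.symm⟩
    obtain ⟨L, hL, -⟩ := Ideal.exists_ltSeries_of_hasGoingUp l P
    rw [← hL]
    exact Order.LTSeries.length_le_krullDim L
  · exact Order.krullDim_le_of_strictMono (PrimeSpectrum.comap (algebraMap R S))
      fun P Q h => Ideal.IsIntegral.comap_lt_comap (R := R) h

/-- The Krull dimension of a finitely generated domain over a field is its transcendence degree:
Noether normalization reduces this to polynomial rings. -/
theorem IsTranscendenceBasis.ringKrullDim_eq {k S ι : Type*} [Field k] [CommRing S] [IsDomain S]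
    [Algebra k S] [Algebra.FiniteType k S] [Finite ι] {x : ι → S}
    (hx : IsTranscendenceBasis k x) : ringKrullDim S = (Nat.card ι : WithBot ℕ∞) := by
  obtain ⟨s, g, hg, hint⟩ := exists_integral_inj_algHom_of_fg k S
  algebraize [g.toRingHom]
  have : IsScalarTower k (MvPolynomial (Fin s) k) S :=
    IsScalarTower.of_algebraMap_eq fun r => (g.commutes r).symm
  have : Algebra.IsIntegral (MvPolynomial (Fin s) k) S := ⟨hint⟩
  have : FaithfulSMul (MvPolynomial (Fin s) k) S :=
    (faithfulSMul_iff_algebraMap_injective _ _).2 hg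
  have hy : IsTranscendenceBasis k
      (algebraMap (MvPolynomial (Fin s) k) S ∘ (MvPolynomial.X : Fin s → _)) :=
    (IsTranscendenceBasis.mvPolynomial (Fin s) k).algebraMap_comp
  have hcard := congrArg Cardinal.toNat (hx.lift_cardinalMk_eq hy)
  simp only [Cardinal.toNat_lift, Cardinal.mk_fin, Cardinal.toNat_natCast] at hcard
  have hcard' : Nat.card ι = s := hcard
  rw [← ringKrullDim_eq_of_isIntegral (R := MvPolynomial (Fin s) k) hg,
    MvPolynomial.ringKrullDim_of_isNoetherianRing, ringKrullDim_eq_zero_of_field, hcard']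
  simp

/-! ### Generic rank of a matrix over a domain -/

/-- Gaussian elimination without denominators. The rows of `M` selected by `a` are a basis of the
row space of `M` over the fraction field: up to the common denominator `g`, the matrix of these
rows has the right inverse `C`, and `D` expresses all rows of `M` through them. -/
theorem Matrix.exists_row_basis {A ρ κ : Type*} [CommRing A] [IsDomain A] [Finite ρ] [Fintype κ]
    [DecidableEq κ] (M : Matrix ρ κ A) :
    ∃ (r : ℕ) (a : Fin r → ρ) (g : A) (C : Matrix κ (Fin r) A) (D : Matrix ρ (Fin r) A), g ≠ 0 ∧
      M.submatrix a id * C = g • (1 : Matrix (Fin r) (Fin r) A) ∧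
      g • M = D * M.submatrix a id := by
  set K := FractionRing A
  let φ := algebraMap A K
  have hφ : Function.Injective φ := IsFractionRing.injective A K
  obtain ⟨β, a', ha', hspan, hli⟩ := exists_linearIndependent' K (M.map φ).row
  have : Finite β := Finite.of_injective a' ha'
  let ε := (Finite.equivFin β).symm
  let a := a' ∘ ε
  have hli : LinearIndependent K ((M.map φ).submatrix a id).row := hli.comp ε ε.injective
  have hspan : Submodule.span K (Set.range ((M.map φ).submatrix a id).row)
      = Submodule.span K (Set.range (M.map φ).row) := by
    rw [← hspan]
    exact congrArg _ (ε.surjective.range_comp ((M.map φ).row ∘ a'))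
  set N := (M.map φ).submatrix a id with hN
  -- a right inverse of the selected rows over the fraction field
  obtain ⟨h, hh⟩ := LinearMap.exists_leftInverse_of_injective N.vecMulLinear
    (LinearMap.ker_eq_bot.2 (Matrix.vecMul_injective_iff.2 hli))
  let C₀ : Matrix κ (Fin (Nat.card β)) K := fun j => h (Pi.single j 1)
  have hC₀ : N * C₀ = 1 := by
    ext i b
    have h1 : h (N i) = (Pi.single i 1 : Fin (Nat.card β) → K) := by
      have := LinearMap.congr_fun hh (Pi.single i 1)
      simpa [Matrix.row_def] using this
    have h2 : N i = ∑ j, N i j • (Pi.single j 1 : κ → K) := by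
      ext j; simp [Pi.single_apply]
    rw [h2, map_sum] at h1
    have h3 := congrFun h1 b
    simp only [map_smul, Finset.sum_apply, Pi.smul_apply, smul_eq_mul] at h3
    rw [Matrix.mul_apply, h3, Matrix.one_apply, Pi.single_apply]
    simp [eq_comm]
  have hD₀ : ∀ i, ∃ c : Fin (Nat.card β) → K, ∑ b, c b • N b = M.map φ i := fun i => by
    have : M.map φ i ∈ Submodule.span K (Set.range N.row) :=
      hspan ▸ Submodule.subset_span ⟨i, rfl⟩
    exact (Submodule.mem_span_range_iff_exists_fun K).1 this
  choose D₀ hD₀ using hD₀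
  obtain ⟨g, hg⟩ := IsLocalization.exist_integer_multiples_of_finite (nonZeroDivisors A)
    (Sum.elim (fun p : κ × Fin (Nat.card β) => C₀ p.1 p.2)
      (fun p : ρ × Fin (Nat.card β) => D₀ p.1 p.2))
  choose w hw using hg
  refine ⟨Nat.card β, a, g, Matrix.of fun j b => w (.inl (j, b)),
    Matrix.of fun i b => w (.inr (i, b)),
    nonZeroDivisors.coe_ne_zero g, ?_, ?_⟩
  · ext i b
    apply hφ
    have h1 := congrFun (congrFun hC₀ i) b
    rw [Matrix.mul_apply] at h1
    simp only [Matrix.mul_apply, Matrix.smul_apply, map_sum, map_mul, smul_eq_mul]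
    have hw' : ∀ j, φ (w (.inl (j, b))) = φ g * C₀ j b := fun j => by
      rw [hw (.inl (j, b)), Algebra.smul_def]; rfl
    simp only [Matrix.of_apply, hw', Matrix.submatrix_apply, id]
    have h4 : φ ((1 : Matrix (Fin (Nat.card β)) (Fin (Nat.card β)) A) i b)
        = (1 : Matrix (Fin (Nat.card β)) (Fin (Nat.card β)) K) i b := by
      simp [Matrix.one_apply, apply_ite φ]
    rw [h4, ← h1, Finset.mul_sum]
    exact Finset.sum_congr rfl fun j _ => by simp [hN]; ring
  · ext i j
    apply hφ
    have h1 := congrFun (hD₀ i) j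
    simp only [Matrix.mul_apply, Matrix.smul_apply, map_sum, map_mul, smul_eq_mul]
    have hw' : ∀ b, φ (w (.inr (i, b))) = φ g * D₀ i b := fun b => by
      rw [hw (.inr (i, b)), Algebra.smul_def]; rfl
    simp only [Matrix.of_apply, hw', Matrix.submatrix_apply, id]
    rw [Matrix.map_apply] at h1
    rw [← h1, Finset.sum_apply, Finset.mul_sum]
    exact Finset.sum_congr rfl fun b _ => by simp [hN]; ring

/-- Wherever the denominator of a row basis does not vanish, the rank of the specialized matrix is
the number of rows in that basis. -/
theorem Matrix.rank_map_of_row_basis {A ρ κ F : Type*} [CommRing A] [Fintype ρ] [Fintype κ]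
    [Field F] (ψ : A →+* F) {M : Matrix ρ κ A} {r : ℕ} {a : Fin r → ρ} {g : A}
    {C : Matrix κ (Fin r) A} {D : Matrix ρ (Fin r) A}
    (hC : M.submatrix a id * C = g • (1 : Matrix (Fin r) (Fin r) A))
    (hD : g • M = D * M.submatrix a id) (hg : ψ g ≠ 0) : (M.map ψ).rank = r := by
  have hC' : (M.map ψ).submatrix a id * C.map ψ = ψ g • (1 : Matrix (Fin r) (Fin r) F) := by
    have := congrArg (fun N : Matrix (Fin r) (Fin r) A => N.map ψ) hC
    simpa [Matrix.map_mul, ← Matrix.submatrix_map, Matrix.map_smul'] using this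
  have hD' : ψ g • M.map ψ = D.map ψ * (M.map ψ).submatrix a id := by
    have := congrArg (fun N : Matrix ρ κ A => N.map ψ) hD
    rw [Matrix.map_mul, ← Matrix.submatrix_map] at this
    rw [← this]
    ext i j
    simp
  apply le_antisymm
  · have : M.map ψ = ((ψ g)⁻¹ • D.map ψ) * (M.map ψ).submatrix a id := by
      rw [Matrix.smul_mul, ← hD', smul_smul, inv_mul_cancel₀ hg, one_smul]
    rw [this]
    exact (Matrix.rank_mul_le_left _ _).trans ((Matrix.rank_le_card_width _).trans (by simp))
  · have h1 : (M.map ψ).submatrix a id * ((ψ g)⁻¹ • C.map ψ) = 1 := by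
      rw [Matrix.mul_smul, hC', smul_smul, inv_mul_cancel₀ hg, one_smul]
    calc r = (1 : Matrix (Fin r) (Fin r) F).rank := by simp
      _ ≤ ((M.map ψ).submatrix a id).rank := h1 ▸ Matrix.rank_mul_le_left _ _
      _ ≤ (M.map ψ).rank := Matrix.rank_submatrix_le _ _ _

/-! ### The closure of a family of linear images -/

open MvPolynomial in
/-- The map `φ` is dual to the parametrization `(t, q) ↦ (M(t) q, t)`, so the quotient is the
coordinate ring of the closure of its image. A transcendence basis of it consists of the `t`
together with the entries of `M(t) q` that belong to a row basis of `M`. -/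
theorem ringKrullDim_quotient_ker_of_row_basis {k σ τ ρ κ : Type*} [Field k] [Fintype σ]
    [Fintype τ] [Fintype κ] {M : Matrix ρ κ (MvPolynomial τ k)} {r : ℕ} {a : Fin r → ρ}
    {g : MvPolynomial τ k} {C' : Matrix κ (Fin r) (MvPolynomial τ k)}
    {D : Matrix ρ (Fin r) (MvPolynomial τ k)} (hg : g ≠ 0)
    (hC : M.submatrix a id * C' = g • (1 : Matrix (Fin r) (Fin r) (MvPolynomial τ k)))
    (hD : g • M = D * M.submatrix a id) (e : ρ ⊕ τ ≃ σ)
    (φ : MvPolynomial σ k →ₐ[k] MvPolynomial κ (MvPolynomial τ k))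
    (hφρ : ∀ i, φ (X (e (.inl i))) = ∑ j, C (M i j) * X j)
    (hφτ : ∀ t, φ (X (e (.inr t))) = C (X t)) :
    ringKrullDim (MvPolynomial σ k ⧸ RingHom.ker φ) = ((r + Fintype.card τ : ℕ) : WithBot ℕ∞) := by
  set K := FractionRing (MvPolynomial τ k)
  set S := MvPolynomial σ k ⧸ RingHom.ker φ
  have : (RingHom.ker φ).IsPrime := RingHom.ker_isPrime φ
  let π : MvPolynomial σ k →ₐ[k] S := Ideal.Quotient.mkₐ k (RingHom.ker φ)
  have hπ : Function.Surjective π := Ideal.Quotient.mkₐ_surjective _ _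
  have hπφ : ∀ p q, φ p = φ q → π p = π q := fun p q h =>
    Ideal.Quotient.eq.2 (by rw [RingHom.mem_ker, map_sub, h, sub_self])
  have : Algebra.FiniteType k S := Algebra.FiniteType.of_surjective π hπ
  let x : Fin r ⊕ τ → S := fun i => π (X (e (i.map a id)))
  let ι : S →ₐ[k] MvPolynomial κ (MvPolynomial τ k) := Ideal.kerLiftAlg φ
  have hι : ∀ p, ι (π p) = φ p := fun p => rfl
  -- solving for `q` over the fraction field makes the selected entries of `M(t) q` independent
  let ψ : MvPolynomial κ (MvPolynomial τ k) →ₐ[k] MvPolynomial (Fin r) K :=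
    (aeval (R := MvPolynomial τ k) fun j => ∑ b,
        C (algebraMap (MvPolynomial τ k) K (C' j b) / algebraMap (MvPolynomial τ k) K g) * X b)
      |>.restrictScalars k
  have hgK : algebraMap (MvPolynomial τ k) K g ≠ 0 := by simpa using hg
  have hψC : ∀ p : MvPolynomial τ k, ψ (C p) = C (algebraMap (MvPolynomial τ k) K p) := fun p => by
    simp [ψ]
  have hψX : ∀ j, ψ (X j) = ∑ b,
      C (algebraMap (MvPolynomial τ k) K (C' j b) / algebraMap (MvPolynomial τ k) K g) * X b :=
    fun j => by simp [ψ]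
  have hx : AlgebraicIndependent k x := by
    apply AlgebraicIndependent.of_comp (ψ.comp ι)
    have h : aeval (ψ.comp ι ∘ x) = (mapAlgHom (IsScalarTower.toAlgHom k (MvPolynomial τ k) K)).comp
        (sumAlgEquiv k (Fin r) τ).toAlgHom := by
      ext1 i
      rcases i with b | t
      · have h1 : ∀ b', ∑ j, M (a b) j * C' j b' = if b = b' then g else 0 := fun b' => by
          have := congrFun (congrFun hC b) b'
          simpa [Matrix.mul_apply, Matrix.one_apply] using this
        have h2 : ∀ b', ∑ j, algebraMap (MvPolynomial τ k) K (M (a b) j) *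
            (algebraMap (MvPolynomial τ k) K (C' j b') / algebraMap (MvPolynomial τ k) K g)
              = if b = b' then 1 else 0 := fun b' => by
          have := congrArg (algebraMap (MvPolynomial τ k) K) (h1 b')
          simp only [map_sum, map_mul] at this
          simp only [← mul_div_assoc, ← Finset.sum_div, this]
          split_ifs <;> simp [hgK]
        have h3 : ψ (φ (X (e (.inl (a b))))) = X b := by
          simp only [hφρ, map_sum, map_mul, hψC, hψX, Finset.mul_sum, ← mul_assoc]
          rw [Finset.sum_comm]
          simp only [← C_mul, ← Finset.sum_mul, ← map_sum, h2]
          simp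
        simpa [x, hι] using h3
      · simp [x, hι, hφτ, hψC]
    rw [algebraicIndependent_iff_injective_aeval, h]
    exact (map_injective _ (IsFractionRing.injective (MvPolynomial τ k) K)).comp
      (sumAlgEquiv k (Fin r) τ).injective
  have hbasis : IsTranscendenceBasis k x := by
    rw [hx.isTranscendenceBasis_iff_isAlgebraic]
    set B := Algebra.adjoin k (Set.range x)
    have hτ : ∀ t, π (X (e (.inr t))) ∈ B := fun t => Algebra.subset_adjoin ⟨.inr t, rfl⟩
    have hτ' : ∀ p : MvPolynomial τ k, π (rename (e ∘ .inr) p) ∈ B := fun p => by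
      have h1 : (aeval fun t => π (X (e (.inr t)))) p = π (rename (e ∘ .inr) p) := by
        rw [← AlgHom.comp_apply]
        congr 1
        ext t
        simp
      rw [← h1, aeval_def]
      exact eval₂_mem (fun i _ => B.algebraMap_mem _) hτ
    have hφr : ∀ p : MvPolynomial τ k, φ (rename (e ∘ .inr) p) = C p := fun p => by
      have h1 : φ.comp (rename (e ∘ .inr)) =
          (IsScalarTower.toAlgHom k (MvPolynomial τ k) (MvPolynomial κ (MvPolynomial τ k))) := by
        ext1 t
        simp [hφτ]
      exact congrArg (fun f => f p) h1
    have hρ : ∀ i, IsAlgebraic B (π (X (e (.inl i)))) := fun i => by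
      have h1 : π (rename (e ∘ .inr) g) * π (X (e (.inl i)))
          = ∑ b, π (rename (e ∘ .inr) (D i b)) * π (X (e (.inl (a b)))) := by
        simp only [← map_mul, ← map_sum]
        apply hπφ
        have h2 : ∀ j, g * M i j = ∑ b, D i b * M (a b) j := fun j => by
          have := congrFun (congrFun hD i) j
          simpa [Matrix.mul_apply] using this
        simp only [map_sum, map_mul, hφr, hφρ, Finset.mul_sum, ← mul_assoc]
        rw [Finset.sum_comm]
        simp only [← C_mul, ← Finset.sum_mul, ← map_sum, h2]
      have h3 : ∑ b, π (rename (e ∘ .inr) (D i b)) * π (X (e (.inl (a b)))) ∈ B :=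
        sum_mem fun b _ => mul_mem (hτ' _) (Algebra.subset_adjoin ⟨.inl b, rfl⟩)
      have h4 : π (rename (e ∘ .inr) g) ≠ 0 := fun h0 => by
        have := congrArg ι h0
        rw [hι, hφr, map_zero] at this
        exact hg (by simpa using this)
      refine ⟨Polynomial.C ⟨_, hτ' g⟩ * Polynomial.X - Polynomial.C ⟨_, h3⟩, fun h0 => ?_, ?_⟩
      · have := congrArg (fun p => Polynomial.coeff p 1) h0
        simp [Polynomial.coeff_C] at this
        exact h4 (congrArg Subtype.val this)
      · simp only [map_sub, map_mul, Polynomial.aeval_C, Polynomial.aeval_X]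
        exact sub_eq_zero.2 h1
    have hgen : ∀ i, IsAlgebraic B (π (X i)) := fun i => by
      obtain ⟨i, rfl⟩ := e.surjective i
      rcases i with i | t
      · exact hρ i
      · exact isAlgebraic_algebraMap (⟨_, hτ t⟩ : B)
    refine ⟨fun s => ?_⟩
    obtain ⟨p, rfl⟩ := hπ s
    induction p using MvPolynomial.induction_on with
    | C c => exact isAlgebraic_algebraMap (algebraMap k B c)
    | add p q hp hq => rw [map_add]; exact hp.add hq
    | mul_X p i hp => rw [map_mul]; exact hp.mul (hgen i)
  rw [hbasis.ringKrullDim_eq]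
  simp

namespace Taylor

open MvPolynomial

/-! ### Polynomials with prescribed exponents -/

noncomputable instance instFintypeExpLE (n m : ℕ) : Fintype (ExpLE n m) :=
  (Finsupp.finite_of_degree_le m).fintype

/-- Exponents `γ` with `|γ| = m`. -/
abbrev ExpEQ (n m : ℕ) : Type := {γ : Fin n →₀ ℕ // γ.degree = m}

noncomputable instance instFintypeExpEQ (n m : ℕ) : Fintype (ExpEQ n m) :=
  ((Finsupp.finite_of_degree_le m).subset fun _ h => le_of_eq h).fintype

/-- Exponents `β` with `1 ≤ |β| ≤ e`: they index the free coefficients of a denominator of degree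
at most `e` with constant term `1`. -/
abbrev DenomExp (n e : ℕ) : Type := {β : Fin n →₀ ℕ // 1 ≤ β.degree ∧ β.degree ≤ e}

noncomputable instance instFintypeDenomExp (n e : ℕ) : Fintype (DenomExp n e) :=
  ((Finsupp.finite_of_degree_le e).subset fun _ h => h.2).fintype

/-- The polynomial with coefficients `c γ` at the exponents satisfying `p`, and zero elsewhere. -/
noncomputable def ofCoeffs {n : ℕ} {R : Type*} [CommRing R] {p : (Fin n →₀ ℕ) → Prop}
    [Fintype {γ // p γ}] (c : {γ // p γ} → R) : MvPolynomial (Fin n) R :=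
  ∑ γ, monomial γ.1 (c γ)

section ofCoeffs

variable {n : ℕ} {R S : Type*} [CommRing R] [CommRing S] {p : (Fin n →₀ ℕ) → Prop}
  [Fintype {γ // p γ}]

theorem coeff_ofCoeffs (c : {γ // p γ} → R) (γ : {γ // p γ}) :
    coeff γ.1 (ofCoeffs c) = c γ := by
  classical
  simp [ofCoeffs, coeff_sum, coeff_monomial, Subtype.val_inj]

theorem coeff_ofCoeffs_of_not (c : {γ // p γ} → R) {γ : Fin n →₀ ℕ} (h : ¬ p γ) :
    coeff γ (ofCoeffs c) = 0 := by
  classical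
  rw [ofCoeffs, coeff_sum]
  refine Finset.sum_eq_zero fun β _ => ?_
  rw [coeff_monomial, if_neg]
  rintro rfl
  exact h β.2

theorem map_ofCoeffs (h : R →+* S) (c : {γ // p γ} → R) :
    map h (ofCoeffs c) = ofCoeffs fun γ => h (c γ) := by
  simp [ofCoeffs, map_monomial]

theorem ofCoeffs_smul (a : R) (c : {γ // p γ} → R) : ofCoeffs (a • c) = a • ofCoeffs c := by
  simp [ofCoeffs, Finset.smul_sum, smul_monomial]

end ofCoeffs

/-! ### The parametrization of the cone over the Taylor variety -/

section param

variable {n d e : ℕ} {R S : Type*} [CommRing R] [CommRing S]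

/-- The matrix of the linear map that sends the coefficients of `q = ∑ q_β x^β`, `1 ≤ |β| ≤ e`, to
the part of degree `d + 1` of the product of `q` with the polynomial `t` of degree at most `d`. -/
noncomputable def topMatrix (e : ℕ) (t : ExpLE n d → R) :
    Matrix (ExpEQ n (d + 1)) (DenomExp n e) R :=
  Matrix.of fun γ β => coeff γ.1 (monomial β.1 1 * ofCoeffs t)

theorem map_topMatrix (h : R →+* S) (t : ExpLE n d → R) :
    (topMatrix e t).map h = topMatrix e fun γ => h (t γ) := by
  ext γ β
  simp [topMatrix, ← map_ofCoeffs, ← coeff_map, map_monomial]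

theorem coeff_ofCoeffs_mul (t : ExpLE n d → R) (q : DenomExp n e → R) (γ : ExpEQ n (d + 1)) :
    coeff γ.1 (ofCoeffs q * ofCoeffs t) = ∑ β, topMatrix e t γ β * q β := by
  rw [ofCoeffs, Finset.sum_mul, coeff_sum]
  refine Finset.sum_congr rfl fun β _ => ?_
  rw [topMatrix, Matrix.of_apply, mul_comm (coeff _ _), ← coeff_C_mul, ← mul_assoc,
    C_mul_monomial, mul_one]

/-- The coefficients of the polynomial of degree at most `d + 1` whose part of degree at most `d`
is `t`, and whose part of degree `d + 1` is that of `q * t`. Such polynomials form the cone over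
the set of Taylor polynomials, `1 - q` being the denominator. -/
noncomputable def param (t : ExpLE n d → R) (q : DenomExp n e → R) : ExpLE n (d + 1) → R :=
  fun γ => if h : γ.1.degree ≤ d then t ⟨γ.1, h⟩ else coeff γ.1 (ofCoeffs q * ofCoeffs t)

theorem map_param (h : R →+* S) (t : ExpLE n d → R) (q : DenomExp n e → R) (γ : ExpLE n (d + 1)) :
    h (param t q γ) = param (fun i => h (t i)) (fun i => h (q i)) γ := by
  unfold param
  split_ifs
  · rfl
  · rw [← map_ofCoeffs, ← map_ofCoeffs, ← map_mul, coeff_map]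

theorem param_smul (a : R) (t : ExpLE n d → R) (q : DenomExp n e → R) :
    param (a • t) q = a • param t q := by
  ext γ
  simp only [param, Pi.smul_apply]
  split_ifs
  · rfl
  · rw [ofCoeffs_smul, mul_smul_comm, coeff_smul]

end param

/-! ### Counting exponents -/

theorem degree_eq_of_not_le {n d : ℕ} (γ : ExpLE n (d + 1)) (h : ¬ γ.1.degree ≤ d) :
    γ.1.degree = d + 1 := by
  have := γ.2
  omega

/-- An exponent of degree at most `d + 1` has degree `d + 1` or at most `d`. -/
noncomputable def expLESuccEquiv (n d : ℕ) : ExpEQ n (d + 1) ⊕ ExpLE n d ≃ ExpLE n (d + 1) where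
  toFun := Sum.elim (fun γ => ⟨γ.1, γ.2.le⟩) (fun γ => ⟨γ.1, γ.2.trans d.le_succ⟩)
  invFun γ := if h : γ.1.degree ≤ d then .inr ⟨γ.1, h⟩ else .inl ⟨γ.1, degree_eq_of_not_le γ h⟩
  left_inv := by
    rintro (γ | γ)
    · simp [γ.2]
    · simp [γ.2]
  right_inv γ := by
    dsimp only
    split_ifs <;> rfl

theorem card_expLE (n m : ℕ) : Fintype.card (ExpLE n m) = (n + m).choose n := by
  let ε : ExpLE n m ≃ {P : Fin (n + 1) → ℕ // ∑ i, P i = m} :=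
    { toFun := fun γ => ⟨Fin.cons (m - γ.1.degree) γ.1, by
        have := γ.2
        rw [Fin.sum_univ_succ]
        simp only [Fin.cons_zero, Fin.cons_succ]
        rw [← Finsupp.degree_eq_sum]
        omega⟩
      invFun := fun P => ⟨Finsupp.equivFunOnFinite.symm (Fin.tail P.1), by
        have := P.2
        rw [Fin.sum_univ_succ] at this
        rw [Finsupp.degree_eq_sum]
        simp only [Finsupp.equivFunOnFinite_symm_apply_apply, Fin.tail]
        omega⟩
      left_inv := fun γ => by ext i; simp
      right_inv := fun P => by
        apply Subtype.ext
        have := P.2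
        rw [Fin.sum_univ_succ] at this
        refine (congrArg₂ _ ?_ ?_).trans (Fin.cons_self_tail P.1)
        · rw [Finsupp.degree_eq_sum]
          simp only [Finsupp.equivFunOnFinite_symm_apply_apply, Fin.tail]
          omega
        · ext i; simp }
  have : Fintype {P : Fin (n + 1) → ℕ // ∑ i, P i = m} := Fintype.ofEquiv _ ε
  rw [Fintype.card_congr (ε.trans (Sym.equivNatSumOfFintype (Fin (n + 1)) m).symm),
    Sym.card_sym_eq_choose, Fintype.card_fin, ← Nat.choose_symm_of_eq_add (a := n) (b := m)] <;>
    simp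

/-! ### The Hilbert function -/

/-- The coefficients of a form of degree `k`. -/
noncomputable def homogeneousCoeffs (n k : ℕ) :
    homogeneousSubmodule (Fin n) ℂ k ≃ₗ[ℂ] (ExpEQ n k → ℂ) :=
  LinearEquiv.ofBijective
    ((LinearMap.pi fun γ : ExpEQ n k => lcoeff ℂ γ.1) ∘ₗ (homogeneousSubmodule (Fin n) ℂ k).subtype)
    ⟨by
      refine (injective_iff_map_eq_zero _).2 fun p hp => ?_
      ext γ
      by_cases h : γ.degree = k
      · exact congrFun hp ⟨γ, h⟩
      · exact ((mem_homogeneousSubmodule _ _).1 p.2).coeff_eq_zero h, fun c => by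
      refine ⟨⟨ofCoeffs c, ?_⟩, ?_⟩
      · rw [mem_homogeneousSubmodule]
        exact IsHomogeneous.sum _ _ _ fun γ _ => isHomogeneous_monomial _ γ.2
      · ext γ
        exact coeff_ofCoeffs c γ⟩

/-- Multiplying `t` by `x^β` and taking the part of degree `d + 1` only sees the part of `t` of
degree `d + 1 - |β|`. -/
theorem topMatrix_apply_eq {n d e : ℕ} {deg : Fin e → ℕ}
    {f : FormTuple n deg} {t : ExpLE n d → ℂ} (he : e ≤ d + 1)
    (hft : ∀ (i : Fin e) (δ : ExpLE n d), δ.1.degree = d - i →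
      t δ = coeff δ.1 (f i : MvPolynomial (Fin n) ℂ))
    (γ : ExpEQ n (d + 1)) (β : DenomExp n e) (i : Fin e) (hi : β.1.degree = i + 1) :
    topMatrix e t γ β = coeff γ.1 (monomial β.1 1 * (f i : MvPolynomial (Fin n) ℂ)) := by
  rw [topMatrix, Matrix.of_apply, coeff_monomial_mul', coeff_monomial_mul']
  split_ifs with h
  · have h1 : (γ.1 - β.1).degree = d - i := by
      have : (γ.1 - β.1).degree + β.1.degree = γ.1.degree := by
        rw [← map_add, tsub_add_cancel_of_le h]
      have := γ.2
      omega
    rw [← hft i ⟨γ.1 - β.1, by omega⟩ h1, ← coeff_ofCoeffs t]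
  · rfl

/-- The forms of degree `d + 1` in the ideal generated by the `f i` are the combinations of the
multiples `x^β f_i` with `|β| = i + 1`, which are the columns of `topMatrix`. -/
theorem map_idealComponent {n d e : ℕ} {deg : Fin e → ℕ} (hdeg : ∀ i, deg i = d - i)
    {f : FormTuple n deg} {t : ExpLE n d → ℂ} (he : e ≤ d + 1)
    (hft : ∀ (i : Fin e) (δ : ExpLE n d), δ.1.degree = d - i →
      t δ = coeff δ.1 (f i : MvPolynomial (Fin n) ℂ)) :
    (idealComponent (Ideal.span (Set.range fun i => (f i : MvPolynomial (Fin n) ℂ))) (d + 1)).map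
      (homogeneousCoeffs n (d + 1)).toLinearMap = LinearMap.range (topMatrix e t).mulVecLin := by
  have hf : ∀ i, (f i : MvPolynomial (Fin n) ℂ).IsHomogeneous (d - i) := fun i =>
    hdeg i ▸ (mem_homogeneousSubmodule _ _).1 (f i).2
  rw [Matrix.range_mulVecLin]
  apply le_antisymm
  · rintro _ ⟨⟨p, hp⟩, hpI, rfl⟩
    obtain ⟨c, rfl⟩ := Ideal.mem_span_range_iff_exists_fun.1 (show p ∈ Ideal.span _ from hpI)
    let V : MvPolynomial (Fin n) ℂ →ₗ[ℂ] (ExpEQ n (d + 1) → ℂ) :=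
      LinearMap.pi fun γ => lcoeff ℂ γ.1
    change V (∑ i, c i * (f i : MvPolynomial (Fin n) ℂ)) ∈ _
    rw [map_sum]
    refine sum_mem fun i _ => ?_
    rw [(c i).as_sum, Finset.sum_mul, map_sum]
    refine sum_mem fun β _ => ?_
    rw [← mul_one (coeff β (c i)), ← smul_eq_mul (coeff β (c i)), ← smul_monomial, smul_mul_assoc,
      map_smul]
    apply Submodule.smul_mem
    have hi := i.2
    by_cases hβ : β.degree = i + 1
    · refine Submodule.subset_span ⟨⟨β, by omega⟩, ?_⟩
      ext γ
      exact topMatrix_apply_eq he hft γ ⟨β, by omega⟩ i hβ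
    · have : V (monomial β 1 * (f i : MvPolynomial (Fin n) ℂ)) = 0 := by
        ext γ
        apply ((isHomogeneous_monomial (1 : ℂ) rfl).mul (hf i)).coeff_eq_zero
        rw [γ.2]
        omega
      rw [this]
      exact zero_mem _
  · rw [Submodule.span_le]
    rintro _ ⟨β, rfl⟩
    have h := β.2
    let i : Fin e := ⟨β.1.degree - 1, by omega⟩
    have hi : β.1.degree = i + 1 := by simp only [i]; omega
    have hd : β.1.degree + (d - i) = d + 1 := by omega
    have hp : monomial β.1 1 * (f i : MvPolynomial (Fin n) ℂ) ∈
        homogeneousSubmodule (Fin n) ℂ (d + 1) :=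
      (mem_homogeneousSubmodule _ _).2 (hd ▸ (isHomogeneous_monomial (1 : ℂ) rfl).mul (hf i))
    refine ⟨⟨_, hp⟩, ?_, ?_⟩
    · change monomial β.1 1 * (f i : MvPolynomial (Fin n) ℂ) ∈ Ideal.span _
      exact Ideal.mul_mem_left _ _ (Ideal.subset_span (Set.mem_range_self i))
    · ext γ
      exact (topMatrix_apply_eq he hft γ β i hi).symm

theorem hilbertFunction_add_rank {n d e : ℕ} {deg : Fin e → ℕ} (hdeg : ∀ i, deg i = d - i)
    {f : FormTuple n deg} {t : ExpLE n d → ℂ} (he : e ≤ d + 1)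
    (hft : ∀ (i : Fin e) (δ : ExpLE n d), δ.1.degree = d - i →
      t δ = coeff δ.1 (f i : MvPolynomial (Fin n) ℂ)) :
    hilbertFunction (Ideal.span (Set.range fun i => (f i : MvPolynomial (Fin n) ℂ))) (d + 1)
      + (topMatrix e t).rank = Fintype.card (ExpEQ n (d + 1)) := by
  have : Module.Finite ℂ (homogeneousSubmodule (Fin n) ℂ (d + 1)) :=
    Module.Finite.equiv (homogeneousCoeffs n (d + 1)).symm
  rw [Matrix.rank, ← map_idealComponent hdeg he hft, LinearEquiv.finrank_map_eq, hilbertFunction,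
    Submodule.finrank_quotient_add_finrank, (homogeneousCoeffs n (d + 1)).finrank_eq,
    Module.finrank_fintype_fun_eq_card]

/-- A nonempty open condition `g(t) ≠ 0` on polynomials `t` of degree at most `d` restricts to one
on tuples of forms, regarded as the homogeneous components of `t` of degrees `d, …, d - e + 1`. -/
theorem forGeneralForms_of_extension {n d e : ℕ} {deg : Fin e → ℕ} (hdeg : ∀ i, deg i = d - i)
    (he : e ≤ d + 1) {g : MvPolynomial (ExpLE n d) ℂ} (hg : g ≠ 0) {p : FormTuple n deg → Prop}
    (h : ∀ f t, (∀ (i : Fin e) (δ : ExpLE n d), δ.1.degree = d - i →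
      t δ = coeff δ.1 (f i : MvPolynomial (Fin n) ℂ)) → eval t g ≠ 0 → p f) :
    ForGeneralForms n deg p := by
  classical
  obtain ⟨v, hv⟩ : ∃ v, eval v g ≠ 0 := by
    by_contra! hv
    exact hg (funext fun v => by simpa using hv v)
  -- the coefficients of `t` that do not occur in the forms are frozen at those of `v`
  let s : ExpLE n d → MvPolynomial (FormIndex n deg) ℂ := fun δ =>
    if hδ : ∃ i : Fin e, δ.1.degree = deg i then X ⟨hδ.choose, δ.1, hδ.choose_spec⟩ else C (v δ)
  have heval : ∀ w, eval w (aeval s g) = eval (fun δ => eval w (s δ)) g := fun w => by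
    have : (eval w).comp (aeval s).toRingHom = eval fun δ => eval w (s δ) := by
      ext <;> simp
    exact RingHom.congr_fun this g
  refine ⟨aeval s g, fun h0 => hv ?_, fun f hf => ?_⟩
  · have h1 := heval fun j => v ⟨j.2.1, by rw [j.2.2, hdeg]; omega⟩
    rw [h0, map_zero] at h1
    rw [h1]
    congr 2
    ext δ
    simp only [s]
    split_ifs <;> simp
  · refine h f (fun δ => eval (formCoords f) (s δ)) (fun i δ hδ => ?_) (heval _ ▸ hf)
    have hδ' : ∃ i : Fin e, δ.1.degree = deg i := ⟨i, hδ.trans (hdeg i).symm⟩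
    have hi : hδ'.choose = i := by
      have h1 := hδ'.choose_spec
      rw [hdeg] at h1
      ext
      have := i.2
      have := hδ'.choose.2
      omega
    simp only [s, dif_pos hδ', eval_X, formCoords]
    rw [hi]

/-! ### Taylor polynomials of rational functions -/

section taylor

variable {n d e : ℕ}

theorem coeff_mul_eq_zero_of_degree_lt {σ R : Type*} [CommRing R] {A B : MvPowerSeries σ R}
    {M N : ℕ} (hA : ∀ δ : σ →₀ ℕ, δ.degree < M → MvPowerSeries.coeff δ A = 0)
    (hB : ∀ δ : σ →₀ ℕ, δ.degree < N → MvPowerSeries.coeff δ B = 0) {γ : σ →₀ ℕ}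
    (hγ : γ.degree < M + N) : MvPowerSeries.coeff γ (A * B) = 0 := by
  classical
  rw [MvPowerSeries.coeff_mul]
  refine Finset.sum_eq_zero fun p hp => ?_
  rw [Finset.HasAntidiagonal.mem_antidiagonal] at hp
  have h : p.1.degree + p.2.degree = γ.degree := by rw [← map_add, hp]
  by_cases h1 : p.1.degree < M
  · rw [hA _ h1, zero_mul]
  · rw [hB _ (by omega), mul_zero]

theorem constantCoeff_coe {σ R : Type*} [CommRing R] (p : MvPolynomial σ R) :
    MvPowerSeries.constantCoeff (p : MvPowerSeries σ R) = constantCoeff p := by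
  rw [← MvPowerSeries.coeff_zero_eq_constantCoeff_apply, coeff_coe, constantCoeff_eq]

theorem coeff_ofCoeffs_denom_zero (q : DenomExp n e → ℂ) : coeff 0 (ofCoeffs q) = 0 :=
  coeff_ofCoeffs_of_not q (by simp)

/-- As `q` has no constant term, `q * T` in degree at most `d + 1` only depends on `T` in degree at
most `d`. -/
theorem coeff_ofCoeffs_mul_congr (q : DenomExp n e → ℂ) {T T' : MvPolynomial (Fin n) ℂ}
    (h : ∀ δ : Fin n →₀ ℕ, δ.degree ≤ d → coeff δ T = coeff δ T') {γ : Fin n →₀ ℕ}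
    (hγ : γ.degree ≤ d + 1) : coeff γ (ofCoeffs q * T) = coeff γ (ofCoeffs q * T') := by
  rw [← sub_eq_zero, ← coeff_sub, ← mul_sub, ← coeff_coe, coe_mul]
  refine coeff_mul_eq_zero_of_degree_lt (M := 1) (N := d + 1) (fun δ hδ => ?_) (fun δ hδ => ?_)
    (by omega)
  · rw [coeff_coe, (Finsupp.degree_eq_zero_iff δ).1 (by omega), coeff_ofCoeffs_denom_zero]
  · rw [coeff_coe, coeff_sub, h δ (by omega), sub_self]

theorem exists_coords_eq_param {T : PolyLE n (d + 1)}
    (hT : IsTaylorPolynomial n d e (d + 1) (T : MvPolynomial (Fin n) ℂ)) :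
    ∃ (t : ExpLE n d → ℂ) (q : DenomExp n e → ℂ), coords T = param t q := by
  obtain ⟨P, Q, hP, hQ, -, hQ0, hT⟩ := hT
  set U := (T : MvPolynomial (Fin n) ℂ) with hU
  let t : ExpLE n d → ℂ := fun δ => coeff δ.1 U
  let q : DenomExp n e → ℂ := fun β => -coeff β.1 Q
  have hq : ofCoeffs q = 1 - Q := by
    ext β
    rw [coeff_sub]
    by_cases hβ : 1 ≤ β.degree ∧ β.degree ≤ e
    · have : β ≠ 0 := by rintro rfl; simp at hβ
      rw [coeff_ofCoeffs q ⟨β, hβ⟩, coeff_one, if_neg this.symm, zero_sub]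
    · rw [coeff_ofCoeffs_of_not q hβ]
      by_cases h0 : β = 0
      · rw [h0, coeff_zero_one, ← constantCoeff_eq, hQ0, sub_self]
      · have h1 : β.degree ≠ 0 := mt (Finsupp.degree_eq_zero_iff β).1 h0
        have h2 : Q.totalDegree < β.degree := by omega
        rw [coeff_one, if_neg (Ne.symm h0), coeff_eq_zero_of_totalDegree_lt h2, sub_self]
  have hQ0' : MvPowerSeries.constantCoeff (Q : MvPowerSeries (Fin n) ℂ) ≠ 0 := by
    rw [constantCoeff_coe, hQ0]
    exact one_ne_zero
  set S : MvPowerSeries (Fin n) ℂ := P * (Q : MvPowerSeries (Fin n) ℂ)⁻¹ with hS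
  have hQS : (Q : MvPowerSeries (Fin n) ℂ) * S = P := by
    rw [hS, mul_left_comm, MvPowerSeries.mul_inv_cancel _ hQ0', mul_one]
  have hR : ∀ δ : Fin n →₀ ℕ, δ.degree < d + 2 →
      MvPowerSeries.coeff δ ((U : MvPowerSeries (Fin n) ℂ) - S) = 0 := fun δ hδ => by
    rw [map_sub, coeff_coe, hT, MvPowerSeries.coeff_truncTotal _ hδ, sub_self]
  refine ⟨t, q, ?_⟩
  ext γ
  rw [param, coords]
  split_ifs with h
  · rfl
  · have hγ : γ.1.degree = d + 1 := degree_eq_of_not_le γ h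
    -- the coefficient of `Q * U` agrees with that of `P`, whose degree is at most `d`
    have h1 : coeff γ.1 (Q * U) = 0 := by
      have h2 : (Q : MvPowerSeries (Fin n) ℂ) * U = P + Q * (U - S) := by
        rw [mul_sub, hQS]
        ring
      have h3 : P.totalDegree < γ.1.degree := by omega
      rw [← coeff_coe, coe_mul, h2, map_add, coeff_coe, coeff_eq_zero_of_totalDegree_lt h3,
        coeff_mul_eq_zero_of_degree_lt (M := 0) (by simp) hR (by omega), add_zero]
    have h4 : coeff γ.1 (ofCoeffs q * ofCoeffs t) = coeff γ.1 (ofCoeffs q * U) :=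
      coeff_ofCoeffs_mul_congr q (fun δ hδ => coeff_ofCoeffs t ⟨δ, hδ⟩) hγ.le
    rw [h4, hq, sub_mul, one_mul, coeff_sub, h1, sub_zero]

theorem isTaylorPolynomial_ofCoeffs_param (t : ExpLE n d → ℂ) (q : DenomExp n e → ℂ)
    (ht : t ⟨0, by simp⟩ = 1) :
    IsTaylorPolynomial n d e (d + 1) (ofCoeffs (param t q)) := by
  set T := ofCoeffs (param t q) with hT
  set Q := 1 - ofCoeffs q with hQ
  have hTt : ∀ δ : Fin n →₀ ℕ, δ.degree ≤ d → coeff δ T = coeff δ (ofCoeffs t) := fun δ hδ => by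
    rw [hT, coeff_ofCoeffs (param t q) ⟨δ, by omega⟩, param, dif_pos hδ,
      coeff_ofCoeffs t ⟨δ, hδ⟩]
  have hQ0 : constantCoeff Q = 1 := by
    rw [hQ, map_sub, map_one, constantCoeff_eq, coeff_ofCoeffs_denom_zero, sub_zero]
  have hT0 : constantCoeff T = 1 := by
    rw [constantCoeff_eq, hTt 0 (by simp), ← ht]
    exact coeff_ofCoeffs t ⟨0, by simp⟩
  let P := MvPowerSeries.truncTotal (d + 1) ((Q * T : MvPolynomial (Fin n) ℂ) :
    MvPowerSeries (Fin n) ℂ)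
  refine ⟨P, Q, ?_, ?_, ?_, hQ0, ?_⟩
  · exact Nat.lt_succ_iff.1 (MvPowerSeries.totalDegree_truncTotal_lt _ d.succ_ne_zero)
  · refine (totalDegree_sub _ _).trans (max_le (by simp) ?_)
    refine totalDegree_finsetSum_le fun β _ => ?_
    refine (totalDegree_monomial_le _ _).trans ?_
    exact β.2.2
  · rw [MvPowerSeries.constantCoeff_truncTotal_eq_ite, if_pos d.succ_pos]
    rw [coe_mul, map_mul, constantCoeff_coe, constantCoeff_coe, hQ0, hT0, mul_one]
  · have hR : ∀ δ : Fin n →₀ ℕ, δ.degree < d + 2 →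
        MvPowerSeries.coeff δ ((Q * T : MvPolynomial (Fin n) ℂ) - P : MvPowerSeries (Fin n) ℂ)
          = 0 := fun δ hδ => by
      rw [map_sub, coeff_coe, coeff_coe, MvPowerSeries.coeff_truncTotal_eq_ite]
      split_ifs with h
      · rw [coeff_coe, sub_self]
      · rw [hQ, sub_mul, one_mul, coeff_sub, coeff_ofCoeffs_mul_congr q hTt (by omega), hT,
          coeff_ofCoeffs (param t q) ⟨δ, by omega⟩, param, dif_neg (by simpa using h), sub_self,
          sub_zero]
    have hQ0' : MvPowerSeries.constantCoeff (Q : MvPowerSeries (Fin n) ℂ) ≠ 0 := by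
      rw [constantCoeff_coe, hQ0]
      exact one_ne_zero
    have hPQ : (P : MvPowerSeries (Fin n) ℂ) * (Q : MvPowerSeries (Fin n) ℂ)⁻¹ =
        T - (Q : MvPowerSeries (Fin n) ℂ)⁻¹ * ((Q * T : MvPolynomial (Fin n) ℂ) - P) := by
      rw [coe_mul, mul_sub, ← mul_assoc, MvPowerSeries.inv_mul_cancel _ hQ0']
      ring
    ext δ
    rw [MvPowerSeries.coeff_truncTotal_eq_ite]
    split_ifs with h
    · rw [hPQ, map_sub, coeff_coe, coeff_mul_eq_zero_of_degree_lt (M := 0) (by simp) hR (by omega),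
        sub_zero]
    · exact coeff_ofCoeffs_of_not _ (by omega)

end taylor

/-! ### The homogeneous ideal of the Taylor variety -/

section ideal

variable {n d e : ℕ}

variable (n d e) in
/-- The map of coordinate rings dual to `param`: it evaluates a polynomial in the coordinates
`c_γ` at the generic point of the cone over the Taylor variety. -/
noncomputable def genericEval : MvPolynomial (ExpLE n (d + 1)) ℂ →ₐ[ℂ]
    MvPolynomial (DenomExp n e) (MvPolynomial (ExpLE n d) ℂ) :=
  aeval (param (fun δ => C (X δ)) X)

theorem eval₂Hom_genericEval (t : ExpLE n d → ℂ) (q : DenomExp n e → ℂ)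
    (F : MvPolynomial (ExpLE n (d + 1)) ℂ) :
    eval₂Hom (eval t) q (genericEval n d e F) = eval (param t q) F := by
  have : (eval₂Hom (eval t) q).comp (genericEval n d e).toRingHom = eval (param t q) := by
    ext γ
    · simp [genericEval, MvPolynomial.algebraMap_apply]
    · have := map_param (eval₂Hom (eval t) q) (fun δ => C (X δ)) X γ
      simpa [genericEval] using this
  exact RingHom.congr_fun this F

theorem eq_zero_of_forall_eval₂Hom {κ τ : Type*} {p : MvPolynomial κ (MvPolynomial τ ℂ)}
    (h : ∀ t q, eval₂Hom (eval t) q p = 0) : p = 0 := by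
  ext β δ
  have h1 : coeff β p = 0 := by
    refine MvPolynomial.funext fun t => ?_
    have h2 : map (eval t) p = 0 := by
      refine MvPolynomial.funext fun q => ?_
      rw [eval_map, map_zero]
      exact h t q
    rw [← coeff_map, h2, coeff_zero, map_zero]
  simp [h1]

theorem mem_ker_genericEval {F : MvPolynomial (ExpLE n (d + 1)) ℂ} :
    F ∈ RingHom.ker (genericEval n d e) ↔
      ∀ (t : ExpLE n d → ℂ) (q : DenomExp n e → ℂ), eval (param t q) F = 0 := by
  refine ⟨fun h t q => ?_, fun h => eq_zero_of_forall_eval₂Hom fun t q => ?_⟩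
  · rw [← eval₂Hom_genericEval, (RingHom.mem_ker).1 h, map_zero]
  · rw [eval₂Hom_genericEval, h]

theorem eval_smul_of_isHomogeneous {σ R : Type*} [CommRing R] {F : MvPolynomial σ R} {k : ℕ}
    (hF : F.IsHomogeneous k) (a : R) (c : σ → R) : eval (a • c) F = a ^ k * eval c F := by
  rw [eval_eq, eval_eq, Finset.mul_sum]
  refine Finset.sum_congr rfl fun δ hδ => ?_
  have hk : ∑ i ∈ δ.support, δ i = k := by
    have := hF (mem_support_iff.1 hδ)
    rwa [show (1 : σ → ℕ) = fun _ => 1 from rfl, ← Finsupp.degree_eq_weight_one] at this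
  simp only [Pi.smul_apply, smul_eq_mul, mul_pow, Finset.prod_mul_distrib,
    Finset.prod_pow_eq_pow_sum, hk]
  ring

theorem homogeneousComponent_mem_ker {F : MvPolynomial (ExpLE n (d + 1)) ℂ}
    (hF : F ∈ RingHom.ker (genericEval n d e)) (k : ℕ) :
    homogeneousComponent k F ∈ RingHom.ker (genericEval n d e) := by
  rw [mem_ker_genericEval] at hF ⊢
  intro t q
  -- the values at the multiples `a • param t q` form a polynomial in `a`
  let p : Polynomial ℂ := ∑ i ∈ Finset.range (F.totalDegree + 1),
    Polynomial.monomial i (eval (param t q) (homogeneousComponent i F))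
  have hp : p = 0 := by
    refine Polynomial.funext fun a => ?_
    have := hF (a • t) q
    rw [param_smul, ← sum_homogeneousComponent F, map_sum] at this
    simp only [eval_smul_of_isHomogeneous (homogeneousComponent_isHomogeneous _ F)] at this
    simp only [p, Polynomial.eval_finsetSum, Polynomial.eval_monomial, Polynomial.eval_zero]
    simpa only [mul_comm] using this
  by_cases hk : k < F.totalDegree + 1
  · have := congrArg (fun p => Polynomial.coeff p k) hp
    simpa [p, Polynomial.finsetSum_coeff, Polynomial.coeff_monomial, hk] using this
  · rw [homogeneousComponent_eq_zero _ _ (by omega), map_zero]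

theorem coords_smul {m : ℕ} (a : ℂ) (T : PolyLE n m) : coords (a • T) = a • coords T := by
  ext γ
  simp [coords]

theorem homogeneousIdeal_taylorVariety :
    homogeneousIdeal (taylorVariety n d e (d + 1)) = RingHom.ker (genericEval n d e) := by
  apply le_antisymm
  · refine Ideal.span_le.2 fun F hF => ?_
    have key : ∀ (t : ExpLE n d → ℂ) (q : DenomExp n e → ℂ), t ⟨0, by simp⟩ ≠ 0 →
        eval (param t q) F = 0 := fun t q ht => by
      set a := t ⟨0, by simp⟩
      set c := param (a⁻¹ • t) q with hc
      have hTay := isTaylorPolynomial_ofCoeffs_param (a⁻¹ • t) q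
        (by simp only [Pi.smul_apply, smul_eq_mul]; exact inv_mul_cancel₀ ht)
      have hmem : ofCoeffs c ∈ PolyLE n (d + 1) := by
        refine (mem_restrictTotalDegree _ _ _).2 ?_
        refine totalDegree_finsetSum_le fun β _ => ?_
        exact (totalDegree_monomial_le _ _).trans β.2
      let T : PolyLE n (d + 1) := ⟨_, hmem⟩
      have hcT : coords T = c := by
        ext γ
        exact coeff_ofCoeffs c γ
      have hT : T ≠ 0 := fun h0 => by
        have h1 := congrFun hcT ⟨0, by simp⟩
        rw [h0] at h1
        have : c ⟨0, by simp⟩ = 1 := by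
          simp [hc, param, ← inv_mul_cancel₀ ht, a]
        rw [this] at h1
        simp [coords] at h1
      have hmk := hF.2 (Projectivization.mk ℂ T hT) fun G hG => hG.2 _ ⟨T, hT, hTay, rfl⟩
      have := hmk (a • T) (by
        rw [Projectivization.submodule_mk]
        exact Submodule.smul_mem _ _ (Submodule.mem_span_singleton_self _))
      rwa [coords_smul, hcT, hc, ← param_smul, smul_smul, mul_inv_cancel₀ ht, one_smul] at this
    -- `key` covers the points with nonzero constant term, and those are dense
    have h : C (X ⟨0, by simp⟩) * genericEval n d e F = 0 := by
      refine eq_zero_of_forall_eval₂Hom fun t q => ?_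
      rw [map_mul, eval₂Hom_genericEval, coe_eval₂Hom, eval₂_C, eval_X]
      by_cases ht : t ⟨0, by simp⟩ = 0
      · rw [ht, zero_mul]
      · rw [key t q ht, mul_zero]
    exact (mul_eq_zero.1 h).resolve_left (by simp)
  · intro F hF
    rw [← sum_homogeneousComponent F]
    refine sum_mem fun k _ => Ideal.subset_span
      ⟨⟨k, homogeneousComponent_isHomogeneous k F⟩, fun p hp => hp _
        ⟨⟨k, homogeneousComponent_isHomogeneous k F⟩, ?_⟩⟩
    rintro _ ⟨T, hT, hTay, rfl⟩ T' hT'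
    rw [Projectivization.submodule_mk] at hT'
    obtain ⟨a, rfl⟩ := Submodule.mem_span_singleton.1 hT'
    obtain ⟨t, q, htq⟩ := exists_coords_eq_param hTay
    rw [coords_smul, htq, ← param_smul]
    exact mem_ker_genericEval.1 (homogeneousComponent_mem_ker hF k) _ _

end ideal

end Taylor

/-! ### The codimension of the Taylor variety -/

open Taylor MvPolynomial in
theorem theorem6p1 (n d e : ℕ) (he : e ≤ d + 1) :
    Taylor.ForGeneralForms n (fun i : Fin e => d - (i : ℕ)) (fun f =>
      Taylor.HasCodimension (Taylor.taylorVariety n d e (d + 1))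
        (Taylor.hilbertFunction
          (Ideal.span (Set.range fun i : Fin e => (f i : MvPolynomial (Fin n) ℂ))) (d + 1))) := by
  classical
  obtain ⟨r, a, g, C', D, hg, hC, hD⟩ :=
    (topMatrix e (X : ExpLE n d → MvPolynomial (ExpLE n d) ℂ)).exists_row_basis
  refine forGeneralForms_of_extension (fun _ => rfl) he hg fun f t hft ht => ?_
  have hrank : (topMatrix e t).rank = r := by
    have := Matrix.rank_map_of_row_basis (eval t) hC hD ht
    simpa [map_topMatrix] using this
  have hcard := hilbertFunction_add_rank (fun _ => rfl) he hft
  rw [hrank] at hcard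
  have hdim := ringKrullDim_quotient_ker_of_row_basis hg hC hD (expLESuccEquiv n d)
    (genericEval n d e)
    (fun γ => by
      have h : ¬ γ.1.degree ≤ d := by have := γ.2; omega
      have hM := map_topMatrix (e := e) (C : _ →+* MvPolynomial (DenomExp n e) _)
        (X : ExpLE n d → MvPolynomial (ExpLE n d) ℂ)
      rw [genericEval, aeval_X, expLESuccEquiv, Equiv.coe_fn_mk, Sum.elim_inl, param, dif_neg h,
        coeff_ofCoeffs_mul _ _ γ, ← hM]
      rfl)
    (fun δ => by
      rw [genericEval, aeval_X, expLESuccEquiv, Equiv.coe_fn_mk, Sum.elim_inr, param,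
        dif_pos δ.2])
  have hpos : 0 < Fintype.card (ExpLE n d) := Fintype.card_pos_iff.2 ⟨⟨0, by simp⟩⟩
  have hsum := Fintype.card_congr (expLESuccEquiv n d)
  rw [Fintype.card_sum, card_expLE n (d + 1)] at hsum
  refine ⟨r + Fintype.card (ExpLE n d) - 1, ?_, by omega⟩
  rw [HasDimension, homogeneousIdeal_taylorVariety, hdim]
  have : r + Fintype.card (ExpLE n d) = r + Fintype.card (ExpLE n d) - 1 + 1 := by omega
  rw [this]
  push_cast
  rfl
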